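/- Let $Q$ be a commutative monoid, written additively, that is fine (cancellative and finitely generated) and sharp ($0$ is its only invertible element). Let $d$ be the rank of its group completion $Q^{gp}$, and let $h:Q\to\mathbb{N}$ be a local homomorphism of monoids, where $\mathbb{N}=\{0,1,2,\dots\}$ under addition and local means that $h(q)$ is invertible in $\mathbb{N}$ (that is, $h(q)=0$) if and only if $q$ is invertible in $Q$. For each real number $r$ define $$B_h(r):=\{q\in Q : h(q)<r\}.$$ Then there exist positive real constants $c$ and $C$ such that, for all sufficiently large real $r$, the set $B_h(r)$ is finite and $$c\,r^d<\#B_h(r)<C\,r^d.$$ -/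

import Mathlib

namespace LogMonoid

/-- The set `Mˣ` of units of a commutative monoid written additively. -/
def units (M : Type*) [AddCommMonoid M] : Set M :=
  {m | ∃ n : M, m + n = 0}

/-- A commutative monoid is sharp if `0` is its only unit. -/
def IsSharp (M : Type*) [AddCommMonoid M] : Prop :=
  units M = {0}

/-- A commutative monoid is integral if it is cancellative. -/
def IsIntegral (M : Type*) [AddCommMonoid M] : Prop :=
  ∀ m n p : M, m + n = p + n → m = p

/-- A commutative monoid is fine if it is integral and finitely generated. -/
structure IsFine (M : Type*) [AddCommMonoid M] : Prop where
  integral : IsIntegral M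
  fg : AddMonoid.FG M

/-- A homomorphism is local if the preimage of the units is the set of units. -/
def IsLocal {P Q : Type*} [AddCommMonoid P] [AddCommMonoid Q] (f : P →+ Q) : Prop :=
  f ⁻¹' units Q = units P

/-- The rank of the group completion `M^gp`. -/
noncomputable def gpRank (M : Type*) [AddCommMonoid M] : ℕ :=
  Module.finrank ℤ (Algebra.GrothendieckAddGroup M)

/-- The set `B_h(r)` of all `q` with `h q < r`, for a real number `r`. -/
def ball {Q : Type*} [AddCommMonoid Q] (h : Q →+ ℕ) (r : ℝ) : Set Q :=
  {q | (h q : ℝ) < r}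

end LogMonoid

namespace LogMonoid

open Algebra

variable {Q : Type*} [AddCommMonoid Q]

/-! Both bounds count points of a box in `ℤ ^ d`. Below (`gpRank_lower_bound`): `d` independent
differences `a i - b i` in the group completion give `(N + 1) ^ d` elements of `Q` on which `h` is
`O(N)`. Above (`gpRank_upper_bound`): `h ≥ 1` on nonzero generators, so `h` controls each coordinate
of `Q → ℤ ^ d`; a ball lands in a box of side `O(r)`, with fibres bounded by the finite kernel. -/

theorem IsLocal.eq_zero_of_map_eq_zero {h : Q →+ ℕ} (hlocal : IsLocal h) (hsharp : IsSharp Q)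
    {q : Q} (hq : h q = 0) : q = 0 := by
  have hmem : q ∈ h ⁻¹' units ℕ := ⟨0, by simp [hq]⟩
  rw [hlocal, hsharp] at hmem
  exact hmem

/-- On a finitely generated monoid, every integer-valued homomorphism is bounded by a multiple of
a homomorphism to `ℕ` with trivial kernel. -/
theorem exists_natAbs_le_mul [AddMonoid.FG Q] {h : Q →+ ℕ} (hker : ∀ q, h q = 0 → q = 0)
    (f : Q →+ ℤ) : ∃ M : ℕ, ∀ q, (f q).natAbs ≤ M * h q := by
  obtain ⟨S, hS⟩ := AddMonoid.FG.fg_top (M := Q)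
  refine ⟨∑ s ∈ S, (f s).natAbs, fun q => ?_⟩
  have hq : q ∈ AddSubmonoid.closure (S : Set Q) := hS ▸ AddSubmonoid.mem_top q
  induction hq using AddSubmonoid.closure_induction with
  | mem s hs =>
    by_cases h0 : h s = 0
    · simp [hker s h0]
    · calc (f s).natAbs ≤ ∑ s ∈ S, (f s).natAbs :=
            Finset.single_le_sum (f := fun s => (f s).natAbs) (fun _ _ => Nat.zero_le _) hs
        _ ≤ _ := Nat.le_mul_of_pos_right _ (Nat.pos_of_ne_zero h0)
  | zero => simp
  | add x y _ _ hx hy =>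
    rw [map_add, map_add, mul_add]
    exact (Int.natAbs_add_le _ _).trans (add_le_add hx hy)

/-- A finitely generated abelian group maps to `ℤ ^ rank` with finite kernel. -/
theorem exists_addMonoidHom_finite_ker (G : Type*) [AddCommGroup G] [Module.Finite ℤ G] :
    ∃ f : G →+ (Fin (Module.finrank ℤ G) → ℤ), Finite f.ker := by
  let T := Submodule.torsion ℤ G
  have hrank : Module.finrank ℤ (G ⧸ T) = Module.finrank ℤ G :=
    finrank_quotient_eq_of_le_torsion le_rfl
  let b := (Module.finBasisOfFinrankEq ℤ (G ⧸ T) hrank).equivFun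
  refine ⟨(b.toLinearMap ∘ₗ T.mkQ).toAddMonoidHom, ?_⟩
  have : Finite T := Module.finite_of_fg_torsion T Submodule.torsion_isTorsion
  refine Set.Finite.subset (Set.toFinite (T : Set G)) fun x hx => ?_
  simpa using hx

/-- A homomorphism to `ℕ` is at most `N * K` on some `(N + 1) ^ gpRank Q` elements. -/
theorem gpRank_lower_bound (h : Q →+ ℕ) :
    ∃ K : ℕ, 0 < K ∧ ∀ N : ℕ, ∃ s : Finset Q,
      s.card = (N + 1) ^ gpRank Q ∧ ∀ q ∈ s, h q ≤ N * K := by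
  classical
  obtain ⟨g, hg⟩ := exists_linearIndependent_of_le_finrank
    (R := ℤ) (M := GrothendieckAddGroup Q) (n := gpRank Q) le_rfl
  have hdiff (x : GrothendieckAddGroup Q) :
      ∃ a b : Q, x = GrothendieckAddGroup.of a - GrothendieckAddGroup.of b := by
    induction x using AddLocalization.ind with
    | H y =>
      refine ⟨y.1, y.2, ?_⟩
      simp [GrothendieckAddGroup.of, ← AddLocalization.mk_zero_eq_addMonoidOf_mk]
  choose a b hab using fun i => hdiff (g i)
  -- Padding with `N - n i` copies of `b i` makes the image `∑ n i • g i` plus a shift independent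
  -- of `n`.
  let F : (Fin (gpRank Q) → ℕ) → ℕ → Q := fun n N => ∑ i, (n i • a i + (N - n i) • b i)
  refine ⟨∑ i, (h (a i) + h (b i)) + 1, Nat.succ_pos _, fun N => ?_⟩
  have hF : Function.Injective fun n : Fin (gpRank Q) → Fin (N + 1) =>
      F (fun i => n i) N := by
    intro m n hmn
    have key (k : Fin (gpRank Q) → Fin (N + 1)) :
        GrothendieckAddGroup.of (F (fun i => k i) N) =
          ∑ i, ((k i : ℕ) : ℤ) • g i + ∑ i, (N : ℤ) • GrothendieckAddGroup.of (b i) := by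
      rw [← Finset.sum_add_distrib, map_sum]
      refine Finset.sum_congr rfl fun i _ => ?_
      have hk : (k i : ℕ) ≤ N := Nat.lt_succ_iff.mp (k i).2
      rw [map_add, map_nsmul, map_nsmul, hab, ← natCast_zsmul, ← natCast_zsmul,
        Nat.cast_sub hk]
      module
    have heq := congrArg (GrothendieckAddGroup.of (M := Q)) hmn
    simp only [key, add_left_inj] at heq
    funext i
    have := linearIndependent_iff_injective_fintypeLinearCombination.mp hg
      (a₁ := fun i => ((m i : ℕ) : ℤ)) (a₂ := fun i => ((n i : ℕ) : ℤ))
      (by simpa [Fintype.linearCombination_apply] using heq)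
    exact Fin.ext (Int.ofNat_inj.mp (congrFun this i))
  refine ⟨Finset.univ.image fun n : Fin (gpRank Q) → Fin (N + 1) => F (fun i => n i) N, ?_, ?_⟩
  · rw [Finset.card_image_of_injective _ hF]
    simp
  · simp only [Finset.mem_image, Finset.mem_univ, true_and, forall_exists_index,
      forall_apply_eq_imp_iff]
    intro n
    rw [map_sum, mul_add, Finset.mul_sum]
    refine le_add_right (Finset.sum_le_sum fun i _ => ?_)
    rw [map_add, map_nsmul, map_nsmul, mul_add, smul_eq_mul, smul_eq_mul]
    have hk : (n i : ℕ) ≤ N := Nat.lt_succ_iff.mp (n i).2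
    gcongr
    exact Nat.sub_le _ _

/-- The sublevel sets of a homomorphism to `ℕ` with trivial kernel grow at most like `n ^ gpRank Q`. -/
theorem gpRank_upper_bound (hfine : IsFine Q) {h : Q →+ ℕ} (hker : ∀ q, h q = 0 → q = 0) :
    ∃ t M : ℕ, ∀ n : ℕ, {q | h q ≤ n}.Finite ∧
      {q | h q ≤ n}.ncard ≤ (2 * (M * n) + 1) ^ gpRank Q * t := by
  classical
  have : AddMonoid.FG Q := hfine.fg
  have : IsCancelAdd Q :=
    { add_left_cancel := fun a b c hbc =>
        hfine.integral b a c (by simpa only [add_comm a] using hbc)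
      add_right_cancel := fun a b c hbc => hfine.integral b a c hbc }
  have : AddGroup.FG (GrothendieckAddGroup Q) := AddGroup.fg_iff_addMonoid_fg.mpr inferInstance
  have : Module.Finite ℤ (GrothendieckAddGroup Q) := Module.Finite.iff_addGroup_fg.mpr this
  obtain ⟨f, hf⟩ := exists_addMonoidHom_finite_ker (GrothendieckAddGroup Q)
  let φ : Q →+ (Fin (gpRank Q) → ℤ) := f.comp GrothendieckAddGroup.of
  choose m hm using fun i => exists_natAbs_le_mul hker ((Pi.evalAddMonoidHom _ i).comp φ)
  refine ⟨Nat.card f.ker, ∑ i, m i, fun n => ?_⟩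
  let N : ℕ := (∑ i, m i) * n
  let B : Finset (Fin (gpRank Q) → ℤ) := Fintype.piFinset fun _ => Finset.Icc (-N : ℤ) N
  have hB : B.card = (2 * N + 1) ^ gpRank Q := by
    rw [Fintype.card_piFinset_const, Int.card_Icc]
    congr 1
    omega
  have hφ (q : {q | h q ≤ n}) : φ q ∈ B := by
    refine Fintype.mem_piFinset.mpr fun i => Finset.mem_Icc.mpr ?_
    have h1 : (φ q i).natAbs ≤ N := (hm i q).trans (Nat.mul_le_mul
      (Finset.single_le_sum (f := m) (fun _ _ => Nat.zero_le _) (Finset.mem_univ i)) q.2)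
    omega
  -- `invFun` picks a base point in each fibre of `f`; the offset from it lies in the kernel.
  have hσ (g : GrothendieckAddGroup Q) : g - Function.invFun f (f g) ∈ f.ker := by
    rw [AddMonoidHom.mem_ker, map_sub, Function.invFun_eq (f := f) ⟨g, rfl⟩, sub_self]
  let ψ : {q | h q ≤ n} → B × f.ker := fun q => (⟨φ q, hφ q⟩, ⟨_, hσ (GrothendieckAddGroup.of q)⟩)
  have hψ : Function.Injective ψ := by
    intro x y hxy
    obtain ⟨h1, h2⟩ := Prod.mk.inj hxy
    have h1 : f (GrothendieckAddGroup.of x.1) = f (GrothendieckAddGroup.of y.1) :=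
      congrArg Subtype.val h1
    have h2 := congrArg Subtype.val h2
    simp only [h1, sub_left_inj] at h2
    exact Subtype.ext (GrothendieckAddGroup.of_injective h2)
  refine ⟨Finite.of_injective ψ hψ, ?_⟩
  have hcard := Nat.card_le_card_of_injective ψ hψ
  rwa [Nat.card_prod, Nat.card_eq_fintype_card (α := B), Fintype.card_coe, hB] at hcard

end LogMonoid

theorem mainTheorem4 {Q : Type*} [AddCommMonoid Q]
    (hsharp : LogMonoid.IsSharp Q) (hfine : LogMonoid.IsFine Q)
    (h : Q →+ ℕ) (hlocal : LogMonoid.IsLocal h) :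
    ∃ c C : ℝ, 0 < c ∧ 0 < C ∧
      ∀ᶠ r : ℝ in Filter.atTop,
        (LogMonoid.ball h r).Finite ∧
          c * r ^ LogMonoid.gpRank Q < ((LogMonoid.ball h r).ncard : ℝ) ∧
          ((LogMonoid.ball h r).ncard : ℝ) < C * r ^ LogMonoid.gpRank Q := by
  obtain ⟨K, hK, hlow⟩ := LogMonoid.gpRank_lower_bound h
  obtain ⟨t, M, hup⟩ := LogMonoid.gpRank_upper_bound hfine
    fun q => hlocal.eq_zero_of_map_eq_zero hsharp (q := q)
  set d := LogMonoid.gpRank Q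
  have hK' : (0 : ℝ) < 2 * K := by positivity
  -- The `/ 2` and `+ 1` make the inequalities strict; `4 * M + 1` comes from `⌈r⌉₊ ≤ 2 * r` for `r
  -- ≥ 1`.
  refine ⟨(1 / (2 * K)) ^ d / 2, (4 * M + 1) ^ d * t + 1, by positivity, by positivity, ?_⟩
  filter_upwards [Filter.eventually_ge_atTop (1 : ℝ)] with r hr
  have hr0 : 0 < r := by linarith
  have hsub : LogMonoid.ball h r ⊆ {q | h q ≤ ⌈r⌉₊} := fun q hq =>
    Nat.cast_le.mp ((le_of_lt hq).trans (Nat.le_ceil r))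
  obtain ⟨hfin, hcard⟩ := hup ⌈r⌉₊
  have hball := hfin.subset hsub
  refine ⟨hball, ?_, ?_⟩
  -- This choice of `N` forces `h ≤ r / 2 < r` on `s`.
  · obtain ⟨s, hs, hsh⟩ := hlow ⌊r / (2 * K)⌋₊
    have hs_sub : (s : Set Q) ⊆ LogMonoid.ball h r := by
      intro q hq
      have h1 : (h q : ℝ) ≤ ⌊r / (2 * K)⌋₊ * K := by exact_mod_cast hsh q hq
      have h2 : (⌊r / (2 * K)⌋₊ : ℝ) * K ≤ r / (2 * K) * K := by
        gcongr
        exact Nat.floor_le (by positivity)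
      have h3 : r / (2 * K) * K = r / 2 := by field_simp
      change (h q : ℝ) < r
      linarith
    have h1 : ((⌊r / (2 * K)⌋₊ + 1 : ℕ) : ℝ) ^ d ≤ (LogMonoid.ball h r).ncard := by
      have := Set.ncard_le_ncard hs_sub hball
      rw [Set.ncard_coe_finset, hs] at this
      exact_mod_cast this
    have h2 : (r / (2 * K)) ^ d ≤ ((⌊r / (2 * K)⌋₊ + 1 : ℕ) : ℝ) ^ d := by
      gcongr
      exact_mod_cast (Nat.lt_floor_add_one _).le
    have h3 : (1 / (2 * K : ℝ)) ^ d / 2 * r ^ d = (r / (2 * K)) ^ d / 2 := by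
      rw [div_pow, div_pow, one_pow]
      ring
    have h4 : 0 < (r / (2 * K)) ^ d := by positivity
    linarith
  · have h1 : ((LogMonoid.ball h r).ncard : ℝ) ≤ (2 * (M * ⌈r⌉₊) + 1) ^ d * t := by
      exact_mod_cast (Set.ncard_le_ncard hsub hfin).trans hcard
    have h2 : (2 * (M * ⌈r⌉₊) + 1 : ℝ) ≤ (4 * M + 1) * r := by
      have h3 : (⌈r⌉₊ : ℝ) ≤ 2 * r := by linarith [Nat.ceil_lt_add_one hr0.le]
      have h4 : (M : ℝ) * ⌈r⌉₊ ≤ M * (2 * r) := by gcongr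
      linarith
    calc ((LogMonoid.ball h r).ncard : ℝ) ≤ (2 * (M * ⌈r⌉₊) + 1) ^ d * t := h1
      _ ≤ ((4 * M + 1) * r) ^ d * t := by gcongr
      _ = (4 * M + 1) ^ d * t * r ^ d := by rw [mul_pow]; ring
      _ < ((4 * M + 1) ^ d * t + 1) * r ^ d := by
        gcongr
        linarith
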